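/- **Theorem 1 (Matrix Painlevé-type difference equations).** Let $a_{4,0},a_{2,2},a_{0,4}\ge 0$ and $a_{2,0},a_{0,2}\in\mathbb R$ with $a_{4,0}+a_{2,2}>0$ and $a_{2,2}+a_{0,4}>0$, put $$W(x,y)=\exp\!\big(-(a_{4,0}x^4+a_{2,2}x^2y^2+a_{0,4}y^4+a_{2,0}x^2+a_{0,2}y^2)\big),\qquad (x,y)\in\mathbb R^2,$$ and assume that all moments $\iint x^jy^k\,W(x,y)\,dx\,dy$, $j,k\ge 0$, are finite (absolutely convergent). Let $(f,g)=\iint f\,g\,W\,dx\,dy$ on real polynomials in $x,y$, and let $\{\mathbb P_n\}_{n\ge 0}$ be an orthonormal polynomial system for this inner product: $\mathbb P_n=(P_{n,0},\dots,P_{n,n})^T$, where $P_{n,0},\dots,P_{n,n}$ are linearly independent polynomials of total degree exactly $n$, $(\mathbb P_n,\mathbb P_n^T)=I_{n+1}$, and $(\mathbb P_n,\mathbb P_m^T)=0$ for $n\ne m$. Let $G_n$ be the $(n+1)\times(n+1)$ leading coefficient matrix, i.e. $\mathbb P_n=G_n\,(x^n,x^{n-1}y,\dots,y^n)^T+(\text{terms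 of lower degree})$. Then $G_n$ is non-singular for every $n\ge 0$, and there are unique real $(n+1)\times(n+2)$ matrices $A_{n,1},A_{n,2}$ ($n\ge 0$) such that the three term relations $$x\,\mathbb P_n=A_{n,1}\mathbb P_{n+1}+A_{n-1,1}^T\mathbb P_{n-1},\qquad y\,\mathbb P_n=A_{n,2}\mathbb P_{n+1}+A_{n-1,2}^T\mathbb P_{n-1}$$ hold for all $n\ge 0$ (with $\mathbb P_{-1}=0$, $A_{-1,i}=0$). With $N_{n+1,1}=\mathrm{diag}(n+1,n,\dots,1)$ and $N_{n+1,2}=\mathrm{diag}(1,2,\dots,n+1)$, these matrices satisfy, for every $n\ge 0$, $$\begin{aligned} 4a_{4,0}\,A_{n,1}&\left[(A_{n+1,1}A_{n+1,1}^T)A_{n,1}^T+A_{n,1}^T(A_{n,1}A_{n,1}^T+A_{n-1,1}^TA_{n-1,1})\right]\\ &+2a_{2,2}\,A_{n,1}\left[(A_{n+1,2}A_{n+1,1}^T)A_{n,2}^T+A_{n,2}^T(A_{n,1}A_{n,2}^T+A_{n-1,1}^TA_{n-1,2})\right]\\ &+2a_{2,0}\,A_{n,1}A_{n,1}^T=G_nN_{n+1,1}G_n^{-1}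 \end{aligned}$$ and $$\begin{aligned} 4a_{0,4}\,A_{n,2}&\left[(A_{n+1,2}A_{n+1,2}^T)A_{n,2}^T+A_{n,2}^T(A_{n,2}A_{n,2}^T+A_{n-1,2}^TA_{n-1,2})\right]\\ &+2a_{2,2}\,A_{n,2}\left[(A_{n+1,1}A_{n+1,2}^T)A_{n,1}^T+A_{n,1}^T(A_{n,2}A_{n,1}^T+A_{n-1,2}^TA_{n-1,1})\right]\\ &+2a_{0,2}\,A_{n,2}A_{n,2}^T=G_nN_{n+1,2}G_n^{-1}. \end{aligned}$$ -/

import Mathlib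

open scoped Matrix
open MeasureTheory

noncomputable section

namespace BivariateFreud

/-- The five real parameters of the polynomial
`q(x,y) = a₄₀ x⁴ + a₂₂ x² y² + a₀₄ y⁴ + a₂₀ x² + a₀₂ y²`. -/
structure Params where
  a40 : ℝ
  a22 : ℝ
  a04 : ℝ
  a20 : ℝ
  a02 : ℝ

/-- The polynomial function `q(x,y)`. -/
def Params.q (a : Params) (x y : ℝ) : ℝ :=
  a.a40 * x ^ 4 + a.a22 * x ^ 2 * y ^ 2 + a.a04 * y ^ 4 + a.a20 * x ^ 2 + a.a02 * y ^ 2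

/-- The bivariate Freud weight `W(x,y) = exp(-q(x,y))`. -/
def Params.weight (a : Params) (x y : ℝ) : ℝ := Real.exp (-(a.q x y))

/-- All moments of the weight exist (as absolutely convergent Lebesgue integrals on `ℝ²`). -/
def Params.HasFiniteMoments (a : Params) : Prop :=
  ∀ j k : ℕ, Integrable (fun p : ℝ × ℝ => p.1 ^ j * p.2 ^ k * a.weight p.1 p.2)

/-- Real polynomials in two variables: `X 0` is `x` and `X 1` is `y`. -/
abbrev Poly := MvPolynomial (Fin 2) ℝ

/-- The inner product `(f, g) = ∬ f g W dx dy`. -/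
def Params.ip (a : Params) (f g : Poly) : ℝ :=
  ∫ p : ℝ × ℝ, MvPolynomial.eval ![p.1, p.2] f * MvPolynomial.eval ![p.1, p.2] g *
    a.weight p.1 p.2

/-- A sequence of column vectors of polynomials, the `n`-th one having `n + 1` entries. -/
abbrev VecSeq := (n : ℕ) → Fin (n + 1) → Poly

/-- A sequence of real matrices, the `n`-th one having size `(n + 1) × (n + 2)`. -/
abbrev MatSeq := (n : ℕ) → Matrix (Fin (n + 1)) (Fin (n + 2)) ℝ

/-- Polynomial systems: the entries of `ℙ_n` have total degree exactly `n` and are linearly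
independent. -/
structure IsPolynomialSystem (P : VecSeq) : Prop where
  degree_eq : ∀ n i, (P n i).totalDegree = n
  linearIndependent : ∀ n, LinearIndependent ℝ (P n)

/-- Orthonormal polynomial systems for the Freud inner product:
`(ℙ_n, ℙ_nᵀ) = I` and `(ℙ_n, ℙ_mᵀ) = 0` for `n ≠ m`. -/
structure IsOrthonormalSystem (a : Params) (P : VecSeq) : Prop extends
    IsPolynomialSystem P where
  ip_self : ∀ n, Matrix.of (fun i j => a.ip (P n i) (P n j)) = 1
  ip_ne : ∀ n m, n ≠ m → Matrix.of (fun i j => a.ip (P n i) (P m j)) = 0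

/-- The leading coefficient matrix `G_n`: its `(i, j)` entry is the coefficient of
`x^(n-j) y^j` in the `i`-th entry of `ℙ_n`. -/
def leadingMatrix (P : VecSeq) (n : ℕ) : Matrix (Fin (n + 1)) (Fin (n + 1)) ℝ :=
  Matrix.of fun i j =>
    (P n i).coeff (Finsupp.single 0 (n - (j : ℕ)) + Finsupp.single 1 (j : ℕ))

/-- `ℙ_{n-1}`, a vector with `n` entries; for `n = 0` it is empty (`ℙ_{-1} = 0`). -/
def prevVec (P : VecSeq) : (n : ℕ) → Fin n → Poly
  | 0 => 0
  | n + 1 => P n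

/-- `A_{n-1}`, a matrix of size `n × (n + 1)`; for `n = 0` it is empty (`A_{-1} = 0`). -/
def prevMat (A : MatSeq) : (n : ℕ) → Matrix (Fin n) (Fin (n + 1)) ℝ
  | 0 => 0
  | n + 1 => A n

/-- `A` is the sequence of matrix coefficients of the three term relations in the variable
number `v`: `x_v ℙ_n = A_n ℙ_{n+1} + A_{n-1}ᵀ ℙ_{n-1}` for all `n ≥ 0`. -/
def ThreeTermRelations (P : VecSeq) (v : Fin 2) (A : MatSeq) : Prop :=
  ∀ n : ℕ, (MvPolynomial.X v : Poly) • P n =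
    (A n).map MvPolynomial.C *ᵥ P (n + 1) + (prevMat A n)ᵀ.map MvPolynomial.C *ᵥ prevVec P n

/-- `N_{n,1} = diag(n, n - 1, …, 1)`. -/
def N₁ (n : ℕ) : Matrix (Fin n) (Fin n) ℝ := Matrix.diagonal fun i => (n : ℝ) - (i : ℕ)

/-- `N_{n,2} = diag(1, 2, …, n)`. -/
def N₂ (n : ℕ) : Matrix (Fin n) (Fin n) ℝ := Matrix.diagonal fun i => ((i : ℕ) : ℝ) + 1

end BivariateFreud

end

/-!
Write `L f = ∬ f W` for the moment functional and `(f, gᵀ) = L (f gᵀ)` for vectors of polynomials.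
Three properties of `W = exp (-q)` are used: `L` is linear on polynomials (finite moments), `L` is
invariant under `(x, y) ↦ (-x, -y)`, and `L (∂_v f) = L (f ∂_v q)` (integration by parts,
`Params.HasFiniteMoments.moment_pderiv`). The rest is algebra.

*Leading matrices and three term relations.* By induction on the degree, each `P n` is orthogonal to
all polynomials of lower degree, and hence the leading coefficient matrix `G_n` is invertible: a
combination of the entries of `P n` that drops degree is orthogonal to `P n`
(`IsOrthonormalFor.apply_mul_eq_zero`). It follows that a polynomial is determined by its Fourier
coefficients. Comparing those of `x_v P n` yields the three term relation with
`A n = (x_v P n, P (n+1)ᵀ)`; the coefficient of `P n` itself vanishes because `P n` has the parity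
of `n` (`IsOrthonormalFor.reflect_eq`).

*Difference equations.* Both sides equal `A n (∂_v P (n+1), (P n)ᵀ)`. On the one hand, `A n P (n+1)`
is `x_v P n` up to lower degree, and `∂_v x_v` multiplies the monomials of degree `n` by their
`v`-exponent plus one, which gives `G_n N G_n⁻¹` (`IsOrthonormalFor.mul_gram_pderiv`). On the other
hand, integration by parts gives `A n (P (n+1), ∂_v q (P n)ᵀ)`
(`IsOrthonormalFor.gram_pderiv`), and the three term relations evaluate the contributions
of the monomials `x_v³`, `x_v x_w²` and `x_v` of `∂_v q` (`IsOrthonormalFor.gram_cubic`).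
-/

noncomputable section

namespace BivariateFreud

open MvPolynomial

/-! ### Moments of the weight -/

/-- The moment functional `f ↦ ∬ f W dx dy`. -/
def Params.moment (a : Params) (f : Poly) : ℝ :=
  ∫ p : ℝ × ℝ, eval ![p.1, p.2] f * a.weight p.1 p.2

lemma Params.ip_eq_moment (a : Params) (f g : Poly) : a.ip f g = a.moment (f * g) := by
  simp [Params.ip, Params.moment]

lemma Params.HasFiniteMoments.integrable {a : Params} (h : a.HasFiniteMoments) (f : Poly) :
    Integrable fun p : ℝ × ℝ => eval ![p.1, p.2] f * a.weight p.1 p.2 := by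
  induction f using MvPolynomial.induction_on' with
  | monomial m c =>
    refine ((h (m 0) (m 1)).const_mul c).congr (.of_forall fun p => ?_)
    simp [eval_monomial, Finsupp.prod_fintype, mul_assoc]
  | add f g hf hg =>
    refine (hf.add hg).congr (.of_forall fun p => ?_)
    simp [add_mul]

lemma Params.HasFiniteMoments.moment_add {a : Params} (h : a.HasFiniteMoments) (f g : Poly) :
    a.moment (f + g) = a.moment f + a.moment g := by
  simp only [Params.moment, map_add, add_mul]
  exact integral_add (h.integrable f) (h.integrable g)

lemma Params.moment_smul (a : Params) (c : ℝ) (f : Poly) :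
    a.moment (c • f) = c * a.moment f := by
  simp only [Params.moment, smul_eval, mul_assoc]
  exact integral_const_mul _ _

/-- The moment functional as a linear form, available once all moments are finite. -/
def Params.HasFiniteMoments.momentₗ {a : Params} (h : a.HasFiniteMoments) : Poly →ₗ[ℝ] ℝ where
  toFun := a.moment
  map_add' := h.moment_add
  map_smul' c f := a.moment_smul c f

/-- The exponent `q(x, y)` as a polynomial. -/
def Params.qPoly (a : Params) : Poly :=
  C a.a40 * X 0 ^ 4 + C a.a22 * (X 0 ^ 2 * X 1 ^ 2) + C a.a04 * X 1 ^ 4 + C a.a20 * X 0 ^ 2 +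
    C a.a02 * X 1 ^ 2

lemma Params.weight_eq (a : Params) (p : ℝ × ℝ) :
    a.weight p.1 p.2 = Real.exp (-(eval ![p.1, p.2] a.qPoly)) := by
  simp [Params.weight, Params.q, Params.qPoly, mul_assoc]

lemma hasDerivAt_eval_add_smul_single (z : Fin 2 → ℝ) (v : Fin 2) (f : Poly) :
    HasDerivAt (fun t : ℝ => eval (z + t • Pi.single v 1) f) (eval z (pderiv v f)) 0 := by
  induction f using MvPolynomial.induction_on with
  | C c => simpa using hasDerivAt_const (0 : ℝ) c
  | add f g hf hg =>
    simp only [map_add]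
    exact hf.add hg
  | mul_X f i hf =>
    have hX : HasDerivAt (fun t : ℝ => eval (z + t • Pi.single v 1) (X i : Poly))
        (eval z (pderiv v (X i : Poly))) 0 := by
      have h1 := ((hasDerivAt_id (0 : ℝ)).mul_const ((Pi.single v 1 : Fin 2 → ℝ) i)).const_add (z i)
      have h2 : eval z (pderiv v (X i : Poly)) = 1 * (Pi.single v 1 : Fin 2 → ℝ) i := by
        rw [pderiv_X]
        rcases eq_or_ne i v with rfl | hiv <;> simp [*]
      rw [h2]
      simpa using h1
    simp only [map_mul, Derivation.leibniz]
    refine (hf.mul hX).congr_deriv ?_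
    simp
    ring

/-- The fundamental theorem of calculus in the direction of the `v`-th coordinate axis: since
`f W` and its derivative are integrable, the latter has integral zero. -/
lemma Params.HasFiniteMoments.moment_pderiv {a : Params} (h : a.HasFiniteMoments) (v : Fin 2)
    (f : Poly) : a.moment (pderiv v f) = a.moment (f * pderiv v a.qPoly) := by
  set e : ℝ × ℝ := ((Pi.single v 1 : Fin 2 → ℝ) 0, (Pi.single v 1 : Fin 2 → ℝ) 1) with he
  have hline (p : ℝ × ℝ) : HasLineDerivAt ℝ
      (fun p : ℝ × ℝ => eval ![p.1, p.2] f * a.weight p.1 p.2)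
      (eval ![p.1, p.2] (pderiv v f - f * pderiv v a.qPoly) * a.weight p.1 p.2) p e := by
    have hpt (t : ℝ) : ![(p + t • e).1, (p + t • e).2] =
        ![p.1, p.2] + t • (Pi.single v 1 : Fin 2 → ℝ) := by
      ext i; fin_cases i <;> simp [he]
    simp only [HasLineDerivAt, Params.weight_eq, hpt]
    refine ((hasDerivAt_eval_add_smul_single _ v f).mul
      (hasDerivAt_eval_add_smul_single _ v a.qPoly).neg.exp).congr_deriv ?_
    simp
    ring
  -- Integration by parts against the constant function `1`; only `f W` and its derivative have to
  -- be integrable.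
  have key := integral_bilinear_hasLineDerivAt_right_eq_neg_left_of_integrable
    (μ := (volume : Measure (ℝ × ℝ))) (B := ContinuousLinearMap.mul ℝ ℝ)
    (f := fun _ => (1 : ℝ)) (f' := fun _ => (0 : ℝ)) (v := e)
    (g := fun p : ℝ × ℝ => eval ![p.1, p.2] f * a.weight p.1 p.2)
    (g' := fun p => eval ![p.1, p.2] (pderiv v f - f * pderiv v a.qPoly) * a.weight p.1 p.2)
    (by simp) (by simpa only [ContinuousLinearMap.mul_apply', one_mul] using h.integrable _)
    (by simpa only [ContinuousLinearMap.mul_apply', one_mul] using h.integrable _)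
    (fun p _ => by simpa [HasLineDerivAt] using hasDerivAt_const (0 : ℝ) (1 : ℝ))
    (fun p _ => hline p)
  simp only [ContinuousLinearMap.mul_apply', one_mul, zero_mul, integral_zero, neg_zero] at key
  have hsub : h.momentₗ (pderiv v f - f * pderiv v a.qPoly) = 0 := key
  rw [map_sub, sub_eq_zero] at hsub
  exact hsub

/-- The central symmetry `f(x, y) ↦ f(-x, -y)` of polynomials. -/
def reflect : Poly →ₐ[ℝ] Poly := aeval fun i => -X i

lemma eval_reflect (z : Fin 2 → ℝ) (f : Poly) : eval z (reflect f) = eval (-z) f := by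
  induction f using MvPolynomial.induction_on with
  | C c => simp [reflect, algebraMap_eq]
  | add f g hf hg => simp [hf, hg]
  | mul_X f i hf => simp [hf, map_mul]; simp [reflect]

lemma coeff_reflect (m : Fin 2 →₀ ℕ) (f : Poly) :
    coeff m (reflect f) = (-1) ^ m.degree * coeff m f := by
  induction f using MvPolynomial.induction_on' with
  | monomial k c =>
    have : reflect (monomial k c) = C ((-1) ^ k.degree) * monomial k c := by
      rw [reflect, aeval_monomial, monomial_eq, algebraMap_eq, Finsupp.degree_eq_sum]
      simp [Finsupp.prod_fintype, neg_pow (X _ : Poly), pow_add]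
      ring
    rw [this, coeff_C_mul]
    by_cases hk : k = m
    · rw [hk]
    · simp [coeff_monomial, hk]
  | add f g hf hg => simp [hf, hg, mul_add]

lemma Params.moment_reflect (a : Params) (f : Poly) : a.moment (reflect f) = a.moment f := by
  rw [Params.moment, Params.moment, ← integral_neg_eq_self]
  refine integral_congr_ae (.of_forall fun p => ?_)
  simp [eval_reflect, Params.weight, Params.q, (by decide : Even 4).neg_pow]

/-! ### Polynomials of bounded degree -/

/-- The polynomials of total degree less than `n`; in particular only `0` for `n = 0`. -/
def degreeLT (n : ℕ) : Submodule ℝ Poly where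
  carrier := {f | ∀ m : Fin 2 →₀ ℕ, n ≤ m.degree → coeff m f = 0}
  add_mem' hf hg m hm := by simp [hf m hm, hg m hm]
  zero_mem' m _ := by simp
  smul_mem' c f hf m hm := by simp [hf m hm]

lemma mem_degreeLT {n : ℕ} {f : Poly} :
    f ∈ degreeLT n ↔ ∀ m : Fin 2 →₀ ℕ, n ≤ m.degree → coeff m f = 0 := Iff.rfl

lemma degreeLT_mono {m n : ℕ} (h : m ≤ n) : degreeLT m ≤ degreeLT n :=
  fun _ hf k hk => hf k (h.trans hk)

lemma degreeLT_zero : degreeLT 0 = ⊥ := by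
  refine (Submodule.eq_bot_iff _).2 fun f hf => ?_
  ext m
  simpa using hf m (Nat.zero_le _)

lemma mem_degreeLT_of_totalDegree {n : ℕ} {f : Poly} (h : f.totalDegree < n) :
    f ∈ degreeLT n := fun m hm =>
  coeff_eq_zero_of_totalDegree_lt (h.trans_le (by rwa [Finsupp.degree_apply] at hm))

lemma X_mul_mem_degreeLT {n : ℕ} {f : Poly} (v : Fin 2) (hf : f ∈ degreeLT n) :
    X v * f ∈ degreeLT (n + 1) := by
  intro m hm
  rw [coeff_X_mul']
  split_ifs with hv
  · have hm' : m - Finsupp.single v 1 + Finsupp.single v 1 = m :=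
      tsub_add_cancel_of_le (by
        rw [Finsupp.single_le_iff]; exact Nat.one_le_iff_ne_zero.2 (Finsupp.mem_support_iff.1 hv))
    refine hf _ ?_
    have := congrArg Finsupp.degree hm'
    rw [map_add, Finsupp.degree_single] at this
    omega
  · rfl

lemma pderiv_mem_degreeLT {n : ℕ} {f : Poly} (v : Fin 2) (hf : f ∈ degreeLT (n + 1)) :
    pderiv v f ∈ degreeLT n := by
  intro m hm
  rw [coeff_pderiv, hf, zero_mul]
  rw [map_add, Finsupp.degree_single]
  omega

lemma reflect_mem_degreeLT {n : ℕ} {f : Poly} (hf : f ∈ degreeLT n) :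
    reflect f ∈ degreeLT n := fun m hm => by rw [coeff_reflect, hf m hm, mul_zero]

/-- The exponent of `x ^ (n - j) * y ^ j`. -/
def topExp (n j : ℕ) : Fin 2 →₀ ℕ := Finsupp.single 0 (n - j) + Finsupp.single 1 j

/-- The monomials of degree `n` are `x ^ (n - j) * y ^ j` with `j ≤ n`, so the vanishing of their
coefficients lowers the degree. -/
lemma mem_degreeLT_of_coeff_topExp {n : ℕ} {f : Poly} (hf : f ∈ degreeLT (n + 1))
    (h : ∀ j : Fin (n + 1), coeff (topExp n j) f = 0) : f ∈ degreeLT n := by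
  intro m hm
  rcases hm.eq_or_lt with hm | hm
  · have hdeg : n = m 0 + m 1 := by simpa [Finsupp.degree_eq_sum] using hm
    have : m = topExp n (m 1) := by
      ext i
      fin_cases i <;> simp [topExp, hdeg]
    rw [this]
    exact h ⟨m 1, by omega⟩
  · exact hf m hm

lemma coeff_topExp_pderiv (n j : ℕ) (v : Fin 2) (f : Poly) :
    coeff (topExp n j) (pderiv v (X v * f)) =
      coeff (topExp n j) f * ((topExp n j v : ℝ) + 1) := by
  rw [coeff_pderiv, add_comm (topExp n j), coeff_X_mul]

/-! ### Matrices of moments -/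

section Gram

variable {ι κ : Type*}

/-- The matrix `L(f gᵀ)` of two column vectors of polynomials, for a linear form `L`. -/
def gram (L : Poly →ₗ[ℝ] ℝ) (f : ι → Poly) (g : κ → Poly) : Matrix ι κ ℝ :=
  Matrix.of fun i j => L (f i * g j)

variable (L : Poly →ₗ[ℝ] ℝ)

lemma gram_apply (f : ι → Poly) (g : κ → Poly) (i : ι) (j : κ) :
    gram L f g i j = L (f i * g j) := rfl

lemma gram_transpose (f : ι → Poly) (g : κ → Poly) : (gram L f g)ᵀ = gram L g f := by
  ext i j
  simp [gram_apply, mul_comm]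

lemma gram_add_left (f f' : ι → Poly) (g : κ → Poly) :
    gram L (f + f') g = gram L f g + gram L f' g := by
  ext i j
  simp [gram_apply, add_mul]

lemma gram_sub_left (f f' : ι → Poly) (g : κ → Poly) :
    gram L (f - f') g = gram L f g - gram L f' g := by
  ext i j
  simp [gram_apply, sub_mul]

lemma gram_add_right (f : ι → Poly) (g g' : κ → Poly) :
    gram L f (g + g') = gram L f g + gram L f g' := by
  ext i j
  simp [gram_apply, mul_add]

lemma gram_smul_right (c : ℝ) (f : ι → Poly) (g : κ → Poly) :
    gram L f (c • g) = c • gram L f g := by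
  ext i j
  simp [gram_apply]

lemma gram_poly_smul (p : Poly) (f : ι → Poly) (g : κ → Poly) :
    gram L (p • f) g = gram L f (p • g) := by
  ext i j
  simp only [gram_apply, Pi.smul_apply, smul_eq_mul]
  congr 1
  ring

lemma gram_mulVec_left {μ : Type*} [Fintype μ] (A : Matrix ι μ ℝ) (f : μ → Poly) (g : κ → Poly) :
    gram L (A.map C *ᵥ f) g = A * gram L f g := by
  ext i j
  simp [gram_apply, Matrix.mulVec, dotProduct, Matrix.mul_apply, Finset.sum_mul,
    ← smul_eq_C_mul]

lemma gram_mulVec_right {μ : Type*} [Fintype μ] (A : Matrix κ μ ℝ) (f : ι → Poly)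
    (g : μ → Poly) : gram L f (A.map C *ᵥ g) = gram L f g * Aᵀ := by
  rw [← gram_transpose, gram_mulVec_left, Matrix.transpose_mul, gram_transpose]

end Gram

lemma map_C_mulVec_mem {ι κ : Type*} [Fintype κ] (S : Submodule ℝ Poly) (A : Matrix ι κ ℝ)
    {f : κ → Poly} (hf : ∀ j, f j ∈ S) (i : ι) : (A.map C *ᵥ f) i ∈ S := by
  simp only [Matrix.mulVec, dotProduct, Matrix.map_apply, ← smul_eq_C_mul]
  exact S.sum_mem fun j _ => S.smul_mem _ (hf j)

lemma coeff_map_C_mulVec {ι κ : Type*} [Fintype κ] (m : Fin 2 →₀ ℕ) (A : Matrix ι κ ℝ)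
    (f : κ → Poly) (i : ι) : coeff m ((A.map C *ᵥ f) i) = ∑ j, A i j * coeff m (f j) := by
  simp [Matrix.mulVec, dotProduct, coeff_sum, coeff_C_mul]

lemma pderiv_map_C_mulVec {ι κ : Type*} [Fintype κ] (v : Fin 2)
    (A : Matrix ι κ ℝ) (f : κ → Poly) :
    (fun i => pderiv v ((A.map C *ᵥ f) i)) = A.map C *ᵥ fun j => pderiv v (f j) := by
  funext i
  simp [Matrix.mulVec, dotProduct, Derivation.leibniz, map_sum]

/-! ### Orthonormal systems of a linear form -/

/-- The algebraic content of being an orthonormal system for the bilinear form `L(f g)`: linear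
independence and the exact degrees are consequences. -/
structure IsOrthonormalFor (L : Poly →ₗ[ℝ] ℝ) (P : VecSeq) : Prop where
  mem_degreeLT : ∀ n i, P n i ∈ degreeLT (n + 1)
  gram_self : ∀ n, gram L (P n) (P n) = 1
  gram_ne : ∀ n m, n ≠ m → gram L (P n) (P m) = 0

namespace IsOrthonormalFor

variable {L : Poly →ₗ[ℝ] ℝ} {P : VecSeq}

/-- Once the system is known to be orthogonal to all polynomials of degree below `n`, no
combination of the entries of `P n` drops degree: such a combination would be orthogonal
to `P n`. -/
lemma isUnit_leadingMatrix_of_gram_eq_zero (hP : IsOrthonormalFor L P) {n : ℕ}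
    (h : ∀ f ∈ degreeLT n, ∀ i, L (f * P n i) = 0) : IsUnit (leadingMatrix P n) := by
  rw [← Matrix.vecMul_injective_iff_isUnit]
  refine (injective_iff_map_eq_zero (Matrix.vecMulLinear (leadingMatrix P n))).2 fun c hc => ?_
  set A : Matrix Unit (Fin (n + 1)) ℝ := Matrix.of fun _ => c
  have hf : (A.map C *ᵥ P n) () ∈ degreeLT n := by
    refine mem_degreeLT_of_coeff_topExp (map_C_mulVec_mem _ _ (hP.mem_degreeLT n) _) fun j => ?_
    rw [coeff_map_C_mulVec]
    exact congrFun hc j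
  have hg := gram_mulVec_left L A (P n) (P n)
  rw [hP.gram_self, Matrix.mul_one] at hg
  ext i
  rw [Pi.zero_apply, ← h _ hf i]
  exact (congrFun (congrFun hg ()) i).symm

/-- A polynomial of degree at most `n` is a combination of the entries of `P n` up to lower
degree, provided that the leading coefficient matrix is invertible. -/
lemma exists_sub_mem_degreeLT (hP : IsOrthonormalFor L P) {n : ℕ}
    (h : IsUnit (leadingMatrix P n)) {f : Poly} (hf : f ∈ degreeLT (n + 1)) :
    ∃ A : Matrix Unit (Fin (n + 1)) ℝ, f - (A.map C *ᵥ P n) () ∈ degreeLT n := by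
  set c : Matrix Unit (Fin (n + 1)) ℝ := Matrix.of fun _ j => coeff (topExp n j) f
  refine ⟨c * (leadingMatrix P n)⁻¹, mem_degreeLT_of_coeff_topExp
    (Submodule.sub_mem _ hf (map_C_mulVec_mem _ _ (hP.mem_degreeLT n) _)) fun j => ?_⟩
  rw [coeff_sub, coeff_map_C_mulVec, sub_eq_zero]
  have : c * (leadingMatrix P n)⁻¹ * leadingMatrix P n = c := by
    rw [Matrix.mul_assoc, Matrix.nonsing_inv_mul _ ((Matrix.isUnit_iff_isUnit_det _).1 h),
      Matrix.mul_one]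
  exact (congrFun (congrFun this ()) j).symm

/-- Each `P k` is orthogonal to all polynomials of degree below `k`. The statement is phrased for
degrees below `N ≤ k` so that induction on `N` can peel off the leading part with `P N`, whose
leading coefficient matrix is invertible by the induction hypothesis. -/
lemma apply_mul_eq_zero (hP : IsOrthonormalFor L P) (N : ℕ) :
    ∀ f ∈ degreeLT N, ∀ k, N ≤ k → ∀ i, L (f * P k i) = 0 := by
  induction N with
  | zero =>
    intro f hf k _ i
    rw [degreeLT_zero, Submodule.mem_bot] at hf
    simp [hf]
  | succ N ih =>
    intro f hf k hk i
    obtain ⟨A, hA⟩ := hP.exists_sub_mem_degreeLT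
      (hP.isUnit_leadingMatrix_of_gram_eq_zero fun f hf => ih f hf N le_rfl) hf
    have h1 := ih _ hA k (by omega) i
    have h2 := gram_mulVec_left L A (P N) (P k)
    rw [hP.gram_ne N k (by omega), Matrix.mul_zero] at h2
    have h3 : L ((A.map C *ᵥ P N) () * P k i) = 0 := congrFun (congrFun h2 ()) i
    rwa [sub_mul, map_sub, h3, sub_zero] at h1

lemma isUnit_leadingMatrix (hP : IsOrthonormalFor L P) (n : ℕ) : IsUnit (leadingMatrix P n) :=
  hP.isUnit_leadingMatrix_of_gram_eq_zero fun f hf => hP.apply_mul_eq_zero n f hf n le_rfl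

lemma gram_eq_zero {ι : Type*} (hP : IsOrthonormalFor L P) {n : ℕ} {f : ι → Poly}
    (hf : ∀ i, f i ∈ degreeLT n) : gram L f (P n) = 0 := by
  ext i j
  exact hP.apply_mul_eq_zero n _ (hf i) n le_rfl j

/-- A polynomial orthogonal to the whole system vanishes. This follows from the orthonormality
relations alone; no positivity of `L` is needed. -/
lemma eq_zero_of_apply_mul_eq_zero (hP : IsOrthonormalFor L P) {N : ℕ} {f : Poly}
    (hf : f ∈ degreeLT N) (h : ∀ k i, L (f * P k i) = 0) : f = 0 := by
  induction N with
  | zero => rwa [degreeLT_zero, Submodule.mem_bot] at hf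
  | succ N ih =>
    obtain ⟨A, hA⟩ := hP.exists_sub_mem_degreeLT (hP.isUnit_leadingMatrix N) hf
    have h2 := gram_mulVec_left L A (P N) (P N)
    rw [hP.gram_self, Matrix.mul_one] at h2
    have hA0 : A = 0 := by
      ext i j
      have h1 := hP.apply_mul_eq_zero N _ hA N le_rfl j
      have h3 : L ((A.map C *ᵥ P N) () * P N j) = A () j := congrFun (congrFun h2 ()) j
      rw [sub_mul, map_sub, h, h3, zero_sub, neg_eq_zero] at h1
      exact h1
    refine ih ?_
    simpa [hA0, Matrix.mulVec, dotProduct] using hA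

/-- A vector of polynomials is determined by its Fourier coefficients. -/
lemma eq_of_gram_eq {ι : Type*} (hP : IsOrthonormalFor L P) {N : ℕ} {f g : ι → Poly}
    (hf : ∀ i, f i ∈ degreeLT N) (hg : ∀ i, g i ∈ degreeLT N)
    (h : ∀ k, gram L f (P k) = gram L g (P k)) : f = g := by
  funext i
  refine sub_eq_zero.1 (hP.eq_zero_of_apply_mul_eq_zero (sub_mem (hf i) (hg i)) fun k j => ?_)
  rw [sub_mul, map_sub, sub_eq_zero]
  exact congrFun (congrFun (h k) i) j

end IsOrthonormalFor

/-! ### Three term relations -/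

/-- The coefficients `(x_v ℙ_n, ℙ_{n+1}ᵀ)` of the three term relations. -/
def recurrenceMat (L : Poly →ₗ[ℝ] ℝ) (P : VecSeq) (v : Fin 2) : MatSeq :=
  fun n => gram L ((X v : Poly) • P n) (P (n + 1))

/-- The right-hand side of the three term relation, paired with `P k`. -/
lemma gram_threeTerm {ι : Type*} (L : Poly →ₗ[ℝ] ℝ) (P : VecSeq) (n k : ℕ)
    (A : Matrix ι (Fin (n + 2)) ℝ) (B : Matrix ι (Fin n) ℝ) :
    gram L (A.map C *ᵥ P (n + 1) + B.map C *ᵥ prevVec P n) (P k) =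
      A * gram L (P (n + 1)) (P k) + B * gram L (prevVec P n) (P k) := by
  rw [gram_add_left, gram_mulVec_left, gram_mulVec_left]

namespace IsOrthonormalFor

variable {L : Poly →ₗ[ℝ] ℝ} {P : VecSeq}

lemma prevVec_mem_degreeLT (hP : IsOrthonormalFor L P) (n : ℕ) (i : Fin n) :
    prevVec P n i ∈ degreeLT n := by
  cases n with
  | zero => exact i.elim0
  | succ n => exact hP.mem_degreeLT n i

lemma gram_prevVec_self (hP : IsOrthonormalFor L P) (n : ℕ) :
    gram L (prevVec P n) (prevVec P n) = 1 := by
  cases n with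
  | zero => exact Subsingleton.elim _ _
  | succ n => exact hP.gram_self n

lemma gram_prevVec (hP : IsOrthonormalFor L P) {n k : ℕ} (h : n ≤ k) :
    gram L (prevVec P n) (P k) = 0 :=
  hP.gram_eq_zero fun i => degreeLT_mono h (hP.prevVec_mem_degreeLT n i)

lemma gram_prevVec_right (hP : IsOrthonormalFor L P) {n k : ℕ} (h : n ≤ k) :
    gram L (P k) (prevVec P n) = 0 := by
  rw [← gram_transpose, hP.gram_prevVec h, Matrix.transpose_zero]

/-- For a centrally symmetric form, the entries of `P n` have the parity of `n`: the difference
of `P n (-x, -y)` and `(-1) ^ n P n (x, y)` has degree below `n` and is orthogonal to all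
polynomials of such degree. -/
lemma reflect_eq (hP : IsOrthonormalFor L P) (hL : ∀ f, L (reflect f) = L f) (n : ℕ)
    (i : Fin (n + 1)) : reflect (P n i) = (-1 : ℝ) ^ n • P n i := by
  have hlow : reflect (P n i) - (-1 : ℝ) ^ n • P n i ∈ degreeLT n := by
    intro m hm
    rw [coeff_sub, coeff_reflect, coeff_smul, smul_eq_mul]
    rcases hm.eq_or_lt with rfl | hm
    · exact sub_self _
    · rw [hP.mem_degreeLT n i m hm]
      simp
  refine sub_eq_zero.1 (hP.eq_zero_of_apply_mul_eq_zero hlow fun k j => ?_)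
  rcases le_or_gt n k with hk | hk
  · exact hP.apply_mul_eq_zero n _ hlow k hk j
  · have hrr : reflect (reflect (P k j)) = P k j := by
      ext m
      rw [coeff_reflect, coeff_reflect, ← mul_assoc, ← mul_pow]
      simp
    have h1 : L (reflect (P n i) * P k j) = 0 := by
      rw [← hrr, ← map_mul, hL, mul_comm]
      exact hP.apply_mul_eq_zero n _ (reflect_mem_degreeLT (degreeLT_mono hk
        (hP.mem_degreeLT k j))) n le_rfl i
    have h2 : L (P n i * P k j) = 0 := congrFun (congrFun (hP.gram_ne n k hk.ne') i) j
    rw [sub_mul, map_sub, h1, smul_mul_assoc, map_smul, h2]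
    simp

lemma gram_X_smul_self (hP : IsOrthonormalFor L P) (hL : ∀ f, L (reflect f) = L f) (v : Fin 2)
    (n : ℕ) : gram L ((X v : Poly) • P n) (P n) = 0 := by
  ext i j
  have h : L (X v * P n i * P n j) = -L (X v * P n i * P n j) := by
    conv_lhs => rw [← hL]
    rw [← map_neg]
    congr 1
    rw [map_mul reflect, map_mul reflect, hP.reflect_eq hL, hP.reflect_eq hL]
    have hX : reflect (X v) = -X v := by simp [reflect]
    have hs : (-1 : ℝ) ^ n * (-1) ^ n = 1 := by rw [← mul_pow]; simp
    rw [hX, mul_smul_comm, mul_smul_comm, smul_mul_assoc, smul_smul, hs, one_smul]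
    ring
  change L (X v * P n i * P n j) = 0
  linarith

theorem threeTermRelations_recurrenceMat (hP : IsOrthonormalFor L P)
    (hL : ∀ f, L (reflect f) = L f) (v : Fin 2) :
    ThreeTermRelations P v (recurrenceMat L P v) := by
  intro n
  have hprev (i : Fin n) : prevVec P n i ∈ degreeLT (n + 2) :=
    degreeLT_mono (by omega) (hP.prevVec_mem_degreeLT n i)
  refine hP.eq_of_gram_eq (N := n + 2) (fun i => X_mul_mem_degreeLT v (hP.mem_degreeLT n i))
    (fun i => add_mem (map_C_mulVec_mem _ _ (hP.mem_degreeLT (n + 1)) i)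
      (map_C_mulVec_mem _ _ hprev i)) fun k => ?_
  rw [gram_threeTerm]
  rcases lt_trichotomy k n with hk | rfl | hk
  · rw [hP.gram_ne _ _ (by omega), Matrix.mul_zero, zero_add]
    obtain ⟨n, rfl⟩ : ∃ m, n = m + 1 := ⟨n - 1, by omega⟩
    change _ = (recurrenceMat L P v n)ᵀ * gram L (P n) (P k)
    rcases (Nat.lt_succ_iff.1 hk).eq_or_lt with rfl | hk
    · rw [hP.gram_self, Matrix.mul_one, recurrenceMat, gram_transpose, gram_poly_smul]
    · rw [hP.gram_ne _ _ hk.ne', Matrix.mul_zero, gram_poly_smul, ← gram_transpose,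
        hP.gram_eq_zero (f := (X v : Poly) • P k) fun i => degreeLT_mono (Nat.succ_le_succ hk)
          (X_mul_mem_degreeLT v (hP.mem_degreeLT k i)), Matrix.transpose_zero]
  · rw [hP.gram_X_smul_self hL, hP.gram_ne _ _ (by omega), hP.gram_prevVec le_rfl,
      Matrix.mul_zero, Matrix.mul_zero, zero_add]
  · rw [hP.gram_prevVec hk.le, Matrix.mul_zero, add_zero]
    rcases (Nat.succ_le_iff.2 hk).eq_or_lt with rfl | hk
    · rw [hP.gram_self, Matrix.mul_one, recurrenceMat]
    · rw [hP.gram_ne _ _ hk.ne, Matrix.mul_zero,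
        hP.gram_eq_zero (f := (X v : Poly) • P n) fun i => degreeLT_mono hk
          (X_mul_mem_degreeLT v (hP.mem_degreeLT n i))]

variable {v w : Fin 2} {A B : MatSeq}

lemma eq_recurrenceMat (hP : IsOrthonormalFor L P) (hA : ThreeTermRelations P v A) :
    A = recurrenceMat L P v := by
  funext n
  rw [recurrenceMat, hA n, gram_threeTerm, hP.gram_self, hP.gram_prevVec (by omega),
    Matrix.mul_one, Matrix.mul_zero, add_zero]

theorem existsUnique_threeTermRelations (hP : IsOrthonormalFor L P)
    (hL : ∀ f, L (reflect f) = L f) (v : Fin 2) : ∃! A : MatSeq, ThreeTermRelations P v A :=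
  ⟨_, hP.threeTermRelations_recurrenceMat hL v, fun _ hA => hP.eq_recurrenceMat hA⟩

/-! ### Moments of cubic multiples -/

lemma gram_X_smul_right (hP : IsOrthonormalFor L P) (hA : ThreeTermRelations P v A) (n : ℕ) :
    gram L (P (n + 1)) ((X v : Poly) • P n) = (A n)ᵀ := by
  rw [hP.eq_recurrenceMat hA, recurrenceMat, gram_transpose]

lemma gram_X_smul_X_smul (hP : IsOrthonormalFor L P) (hA : ThreeTermRelations P v A)
    (hB : ThreeTermRelations P w B) (n : ℕ) :
    gram L ((X v : Poly) • P n) ((X w : Poly) • P n) =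
      A n * (B n)ᵀ + (prevMat A n)ᵀ * prevMat B n := by
  rw [hA n, hB n, gram_add_left, gram_add_right, gram_add_right]
  simp only [gram_mulVec_left, gram_mulVec_right]
  rw [hP.gram_self, hP.gram_prevVec_self, hP.gram_prevVec (by omega),
    hP.gram_prevVec_right (by omega)]
  simp

lemma gram_X_smul_X_smul_prevVec (hP : IsOrthonormalFor L P) (hA : ThreeTermRelations P v A)
    (hB : ThreeTermRelations P w B) (n : ℕ) :
    gram L ((X v : Poly) • P (n + 1)) ((X w : Poly) • prevVec P n) =
      (A n)ᵀ * (prevMat B n)ᵀ := by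
  cases n with
  | zero => ext i j; exact j.elim0
  | succ n =>
    change gram L _ ((X w : Poly) • P n) = (A (n + 1))ᵀ * (B n)ᵀ
    rw [hA (n + 2), hB n, gram_add_left, gram_add_right, gram_add_right]
    simp only [gram_mulVec_left, gram_mulVec_right]
    have h : gram L (prevVec P (n + 2)) (P (n + 1)) = 1 := hP.gram_self (n + 1)
    have h' : gram L (prevVec P (n + 2)) (prevVec P n) = 0 :=
      hP.gram_prevVec_right (n := n) (k := n + 1) (by omega)
    rw [hP.gram_ne _ _ (by omega), hP.gram_prevVec_right (by omega), h, h']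
    simp [prevMat]

/-- The moments `(x_v x_w² ℙ_{n+1}, ℙ_nᵀ)`. -/
lemma gram_cubic (hP : IsOrthonormalFor L P) (hA : ThreeTermRelations P v A)
    (hB : ThreeTermRelations P w B) (n : ℕ) :
    gram L (P (n + 1)) ((X v * X w ^ 2 : Poly) • P n) =
      (B (n + 1) * (A (n + 1))ᵀ) * (B n)ᵀ +
        (B n)ᵀ * (A n * (B n)ᵀ + (prevMat A n)ᵀ * prevMat B n) := by
  have h : (X v * X w ^ 2 : Poly) • P n = (X w * X v : Poly) • (X w : Poly) • P n := by
    rw [smul_smul]; congr 1; ring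
  rw [h, hB n, smul_add, gram_add_right, ← gram_poly_smul, ← gram_poly_smul, gram_mulVec_right,
    gram_mulVec_right, mul_comm, mul_smul, gram_poly_smul L (X v), gram_poly_smul L (X v),
    hP.gram_X_smul_X_smul hB hA, hP.gram_X_smul_X_smul_prevVec hB hA]
  change (_ + (B n)ᵀ * A n) * _ + _ = _
  rw [Matrix.transpose_transpose, Matrix.add_mul, Matrix.mul_add, Matrix.mul_assoc (B n)ᵀ,
    Matrix.mul_assoc (B n)ᵀ]
  exact add_assoc _ _ _

/-! ### Derivatives and leading coefficients -/

/-- Multiplying by `x_v` and differentiating in `x_v` scales each monomial of degree `n` by its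
exponent plus one, which in the basis `P n` becomes conjugation by the leading matrix. -/
lemma gram_pderiv_X_mul (hP : IsOrthonormalFor L P) (v : Fin 2) (n : ℕ) :
    gram L (fun i => pderiv v (X v * P n i)) (P n) =
      leadingMatrix P n * Matrix.diagonal (fun j : Fin (n + 1) => (topExp n j v : ℝ) + 1) *
        (leadingMatrix P n)⁻¹ := by
  set D := Matrix.diagonal (fun j : Fin (n + 1) => (topExp n j v : ℝ) + 1)
  set M := leadingMatrix P n * D * (leadingMatrix P n)⁻¹ with hM
  have hMG : M * leadingMatrix P n = leadingMatrix P n * D := by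
    rw [hM, Matrix.mul_assoc, Matrix.nonsing_inv_mul _
      ((Matrix.isUnit_iff_isUnit_det _).1 (hP.isUnit_leadingMatrix n)), Matrix.mul_one]
  have hlow (i : Fin (n + 1)) :
      ((fun i => pderiv v (X v * P n i) : Fin (n + 1) → Poly) - M.map C *ᵥ P n) i ∈ degreeLT n := by
    refine mem_degreeLT_of_coeff_topExp (sub_mem (pderiv_mem_degreeLT v
      (X_mul_mem_degreeLT v (hP.mem_degreeLT n i)))
      (map_C_mulVec_mem _ _ (hP.mem_degreeLT n) i)) fun j => ?_
    rw [Pi.sub_apply, coeff_sub, coeff_topExp_pderiv, coeff_map_C_mulVec, sub_eq_zero]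
    have := congrFun (congrFun hMG i) j
    rw [Matrix.mul_diagonal] at this
    exact this.symm
  have h := hP.gram_eq_zero hlow
  rwa [gram_sub_left, gram_mulVec_left, hP.gram_self, Matrix.mul_one, sub_eq_zero] at h

lemma mul_gram_pderiv (hP : IsOrthonormalFor L P) (hA : ThreeTermRelations P v A) (n : ℕ) :
    A n * gram L (fun i => pderiv v (P (n + 1) i)) (P n) =
      leadingMatrix P n * Matrix.diagonal (fun j : Fin (n + 1) => (topExp n j v : ℝ) + 1) *
        (leadingMatrix P n)⁻¹ := by
  -- The derivative of the three term relation; its `P (n - 1)` part is orthogonal to `P n`.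
  have hsplit : (fun i => pderiv v (X v * P n i)) =
      ((A n).map C *ᵥ fun j => pderiv v (P (n + 1) j)) +
        ((prevMat A n)ᵀ.map C *ᵥ fun j => pderiv v (prevVec P n j)) := by
    rw [← pderiv_map_C_mulVec, ← pderiv_map_C_mulVec]
    funext i
    rw [Pi.add_apply, ← map_add]
    exact congrArg (pderiv v) (congrFun (hA n) i)
  rw [← hP.gram_pderiv_X_mul v n, hsplit, gram_add_left, gram_mulVec_left, gram_mulVec_left,
    hP.gram_eq_zero (f := fun j => pderiv v (prevVec P n j)) fun j => pderiv_mem_degreeLT v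
      (degreeLT_mono (Nat.le_succ n) (hP.prevVec_mem_degreeLT n j)), Matrix.mul_zero, add_zero]

/-- Integration by parts moves the derivative from `P (n + 1)` to the weight; the derivative of
`P n` does not contribute, its degree being too low. -/
lemma gram_pderiv (hP : IsOrthonormalFor L P) {ψ : Poly}
    (hψ : ∀ f, L (pderiv v f) = L (f * ψ)) (n : ℕ) :
    gram L (fun i => pderiv v (P (n + 1) i)) (P n) = gram L (P (n + 1)) (ψ • P n) := by
  ext i j
  have h0 : L (pderiv v (P n j) * P (n + 1) i) = 0 :=
    hP.apply_mul_eq_zero (n + 1) _ (degreeLT_mono (Nat.le_succ n)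
      (pderiv_mem_degreeLT v (hP.mem_degreeLT n j))) _ le_rfl i
  have h1 := hψ (P (n + 1) i * P n j)
  rw [Derivation.leibniz, smul_eq_mul, smul_eq_mul, map_add, mul_comm (P (n + 1) i) (pderiv _ _),
    h0, zero_add, mul_comm (P n j)] at h1
  rw [gram_apply, h1, gram_apply, Pi.smul_apply, smul_eq_mul]
  congr 1
  ring

/-- The difference equation in the variable `x_v`, for a form whose logarithmic derivative is
`c₄ x_v³ + c₂₂ x_v x_w² + c₂ x_v`. -/
theorem difference_equation (hP : IsOrthonormalFor L P) {c₄ c₂₂ c₂ : ℝ}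
    (hψ : ∀ f, L (pderiv v f) = L (f * (c₄ • (X v * X v ^ 2) + c₂₂ • (X v * X w ^ 2) + c₂ • X v)))
    (hA : ThreeTermRelations P v A) (hB : ThreeTermRelations P w B) (n : ℕ) :
    c₄ • (A n * ((A (n + 1) * (A (n + 1))ᵀ) * (A n)ᵀ +
        (A n)ᵀ * (A n * (A n)ᵀ + (prevMat A n)ᵀ * prevMat A n))) +
      c₂₂ • (A n * ((B (n + 1) * (A (n + 1))ᵀ) * (B n)ᵀ +
        (B n)ᵀ * (A n * (B n)ᵀ + (prevMat A n)ᵀ * prevMat B n))) +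
      c₂ • (A n * (A n)ᵀ) =
    leadingMatrix P n * Matrix.diagonal (fun j : Fin (n + 1) => (topExp n j v : ℝ) + 1) *
      (leadingMatrix P n)⁻¹ := by
  rw [← hP.mul_gram_pderiv hA, hP.gram_pderiv hψ]
  simp only [add_smul, smul_assoc, gram_add_right, gram_smul_right]
  rw [hP.gram_cubic hA hA, hP.gram_cubic hA hB, hP.gram_X_smul_right hA]
  simp only [Matrix.mul_add, Matrix.mul_smul, smul_add]

end IsOrthonormalFor

/-! ### The bivariate Freud weight -/

lemma IsOrthonormalSystem.isOrthonormalFor {a : Params} (h : a.HasFiniteMoments) {P : VecSeq}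
    (hP : IsOrthonormalSystem a P) : IsOrthonormalFor h.momentₗ P where
  mem_degreeLT n i := mem_degreeLT_of_totalDegree (by rw [hP.degree_eq]; exact Nat.lt_succ_self n)
  gram_self n := by
    rw [← hP.ip_self n]
    ext i j
    exact (a.ip_eq_moment _ _).symm
  gram_ne n m hnm := by
    rw [← hP.ip_ne n m hnm]
    ext i j
    exact (a.ip_eq_moment _ _).symm

lemma Params.pderiv_zero_qPoly (a : Params) : pderiv 0 a.qPoly =
    (4 * a.a40) • (X 0 * X 0 ^ 2) + (2 * a.a22) • (X 0 * X 1 ^ 2) + (2 * a.a20) • X 0 := by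
  simp [Params.qPoly, Derivation.leibniz, Derivation.leibniz_pow, pderiv_X, smul_eq_C_mul]
  rw [map_ofNat C 4, map_ofNat C 2]
  ring

lemma Params.pderiv_one_qPoly (a : Params) : pderiv 1 a.qPoly =
    (4 * a.a04) • (X 1 * X 1 ^ 2) + (2 * a.a22) • (X 1 * X 0 ^ 2) + (2 * a.a02) • X 1 := by
  simp [Params.qPoly, Derivation.leibniz, Derivation.leibniz_pow, pderiv_X, smul_eq_C_mul]
  rw [map_ofNat C 4, map_ofNat C 2]
  ring

lemma diagonal_topExp_zero (n : ℕ) :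
    Matrix.diagonal (fun j : Fin (n + 1) => (topExp n j 0 : ℝ) + 1) = N₁ (n + 1) := by
  rw [N₁]
  congr 1
  funext j
  have hj : (j : ℕ) ≤ n := Nat.lt_succ_iff.1 j.2
  simp [topExp, Nat.cast_sub hj]
  ring

lemma diagonal_topExp_one (n : ℕ) :
    Matrix.diagonal (fun j : Fin (n + 1) => (topExp n j 1 : ℝ) + 1) = N₂ (n + 1) := by
  simp [N₂, topExp]

end BivariateFreud

end

open BivariateFreud in
theorem theorem1 (a : Params)
    (h40 : 0 ≤ a.a40) (h22 : 0 ≤ a.a22) (h04 : 0 ≤ a.a04)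
    (hx : 0 < a.a40 + a.a22) (hy : 0 < a.a22 + a.a04)
    (hmom : a.HasFiniteMoments)
    (P : VecSeq) (hP : IsOrthonormalSystem a P) :
    (∀ n : ℕ, IsUnit (leadingMatrix P n)) ∧
    (∃! A₁ : MatSeq, ThreeTermRelations P 0 A₁) ∧
    (∃! A₂ : MatSeq, ThreeTermRelations P 1 A₂) ∧
    ∀ A₁ A₂ : MatSeq, ThreeTermRelations P 0 A₁ → ThreeTermRelations P 1 A₂ →
      ∀ n : ℕ,
        ((4 * a.a40) • (A₁ n * ((A₁ (n + 1) * (A₁ (n + 1))ᵀ) * (A₁ n)ᵀ +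
              (A₁ n)ᵀ * (A₁ n * (A₁ n)ᵀ + (prevMat A₁ n)ᵀ * prevMat A₁ n))) +
          (2 * a.a22) • (A₁ n * ((A₂ (n + 1) * (A₁ (n + 1))ᵀ) * (A₂ n)ᵀ +
              (A₂ n)ᵀ * (A₁ n * (A₂ n)ᵀ + (prevMat A₁ n)ᵀ * prevMat A₂ n))) +
          (2 * a.a20) • (A₁ n * (A₁ n)ᵀ) =
            leadingMatrix P n * N₁ (n + 1) * (leadingMatrix P n)⁻¹) ∧
        ((4 * a.a04) • (A₂ n * ((A₂ (n + 1) * (A₂ (n + 1))ᵀ) * (A₂ n)ᵀ +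
              (A₂ n)ᵀ * (A₂ n * (A₂ n)ᵀ + (prevMat A₂ n)ᵀ * prevMat A₂ n))) +
          (2 * a.a22) • (A₂ n * ((A₁ (n + 1) * (A₂ (n + 1))ᵀ) * (A₁ n)ᵀ +
              (A₁ n)ᵀ * (A₂ n * (A₁ n)ᵀ + (prevMat A₂ n)ᵀ * prevMat A₁ n))) +
          (2 * a.a02) • (A₂ n * (A₂ n)ᵀ) =
            leadingMatrix P n * N₂ (n + 1) * (leadingMatrix P n)⁻¹) := by

  have h := hP.isOrthonormalFor hmom
  have hL := a.moment_reflect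
  refine ⟨h.isUnit_leadingMatrix, h.existsUnique_threeTermRelations hL 0,
    h.existsUnique_threeTermRelations hL 1, fun A₁ A₂ hA₁ hA₂ n => ⟨?_, ?_⟩⟩
  · rw [← diagonal_topExp_zero]
    refine h.difference_equation (fun f => ?_) hA₁ hA₂ n
    rw [← a.pderiv_zero_qPoly]
    exact hmom.moment_pderiv 0 f
  · rw [← diagonal_topExp_one]
    refine h.difference_equation (fun f => ?_) hA₂ hA₁ n
    rw [← a.pderiv_one_qPoly]
    exact hmom.moment_pderiv 1 f
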